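/- Let $\mathsf{FI}$ be the category of finite sets and injections. An $\mathsf{FI}$-module is a functor $M\colon \mathsf{FI}\to\mathsf{Ab}$, and an $\mathsf{FI}^{\mathrm{op}}$-module is a functor $\mathsf{FI}^{\mathrm{op}}\to\mathsf{Ab}$; write $[n]=\{1,\dots,n\}$. We use the following definitions. (1) An $\mathsf{FI}$-module $M$ is presented in finite degree if, for some $k\in\mathbb N$, it is isomorphic to the cokernel of a map $\bigoplus_{j\in J}\mathbb Z\mathsf{FI}([b_j],-)\to\bigoplus_{i\in I}\mathbb Z\mathsf{FI}([a_i],-)$ with all $a_i,b_j\le k$, where the index sets $I$ and $J$ may be infinite. (2) $\Sigma M=M([1]\sqcup -)$ is the shift of $M$, and $M\to\Sigma M$ is the map induced by the inclusions $S\subseteq[1]\sqcup S$. An $\mathsf{FI}$-module $M$ presented in finite degree has polynomial degree $\le 0$ if it is eventually constant, that is, there is an $N$ such that every injection $S\to T$ with $|S|\ge N$ induces an isomorphism $M_S\to M_T$; for $d\ge 1$, it has polynomial degree $\le d$ if $\operatorname{coker}(M\to\Sigma M)$ has polynomial degree $\le d-1$. (3) For $\ell\in\mathbb N$, $\Xi(\ell)$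 is the $\mathsf{FI}^{\mathrm{op}}$-module $\Xi(\ell)_S=H_0(X_S,A_S;\mathbb Z)$, where $X_S=\mathrm{Emb}(S,[\ell]\sqcup\mathbb R)$ is the space of injections $\phi\colon S\to[\ell]\sqcup\mathbb R$ with the topology of pointwise convergence, $A_S\subseteq X_S$ is the subspace of those $\phi$ with $[\ell]\not\subseteq\operatorname{im}\phi$, $H_0$ is relative singular homology, and injections act by precomposition. (4) For an $\mathsf{FI}$-module $M$ and an $\mathsf{FI}^{\mathrm{op}}$-module $N$, the tensor product $M\otimes_{\mathsf{FI}}N$ is the quotient of $\bigoplus_{n\in\mathbb N}M_{[n]}\otimes_{\mathbb Z}N_{[n]}$ by the subgroup generated by all $M_f(y)\otimes x-y\otimes N_f(x)$, for injections $f\colon[m]\to[n]$, $y\in M_{[m]}$ and $x\in N_{[n]}$. Corollary. Let $M$ be an $\mathsf{FI}$-module presented in finite degree, let $d\in\mathbb N$, and assume that $M$ has polynomial degree $\le d$. Then the tail invariant $M\otimes_{\mathsf{FI}}\Xi(\ell)$ is zero for every integer $\ell>d$. -/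

import Mathlib

open CategoryTheory CategoryTheory.Limits
open scoped TensorProduct

universe u v

/-- The category `FI`: objects are finite sets, morphisms are injections. -/
structure FI : Type 1 where
  carrier : Type
  [finite : Finite carrier]

namespace FI

attribute [instance] FI.finite

instance : Category FI where
  Hom S T := S.carrier ↪ T.carrier
  id S := Function.Embedding.refl S.carrier
  comp f g := Function.Embedding.trans f g

/-- The underlying injection of a morphism of `FI`. -/
def emb {S T : FI} (f : S ⟶ T) : S.carrier ↪ T.carrier := f

/-- The standard finite set with `n` elements. -/
def std (n : ℕ) : FI := ⟨Fin n⟩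

/-- The functor `[1] ⊔ - : FI ⥤ FI`. -/
def addPoint : FI ⥤ FI where
  obj S := ⟨Fin 1 ⊕ S.carrier⟩
  map f := Function.Embedding.sumMap (Function.Embedding.refl (Fin 1)) (emb f)
  map_id S := by
    apply Function.Embedding.ext
    rintro (x | x) <;> rfl
  map_comp f g := by
    apply Function.Embedding.ext
    rintro (x | x) <;> rfl

/-- The natural inclusion `S ⊆ [1] ⊔ S`. -/
def inclAddPoint : 𝟭 FI ⟶ addPoint where
  app S := (Function.Embedding.inr : S.carrier ↪ Fin 1 ⊕ S.carrier)
  naturality S T f := by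
    apply Function.Embedding.ext
    intro x
    rfl

end FI

/-- `FI`-modules: functors from `FI` to abelian groups. -/
abbrev FIMod := FI ⥤ AddCommGrpCat.{u}

/-- `FIᵒᵖ`-modules. -/
abbrev FIopMod := FIᵒᵖ ⥤ AddCommGrpCat.{v}

noncomputable section

namespace FIMod

/-- The shift `ΣM = M([1] ⊔ -)`. -/
def shift (M : FIMod.{u}) : FIMod.{u} := FI.addPoint ⋙ M

/-- The natural map `M ⟶ ΣM` induced by the inclusions `S ⊆ [1] ⊔ S`. -/
def toShift (M : FIMod.{u}) : M ⟶ shift M where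
  app S := M.map (FI.inclAddPoint.app S)
  naturality S T f := by
    have h := FI.inclAddPoint.naturality f
    change M.map f ≫ M.map (FI.inclAddPoint.app T) =
      M.map (FI.inclAddPoint.app S) ≫ M.map (FI.addPoint.map f)
    rw [← M.map_comp, ← M.map_comp, ← h]
    rfl

/-- The disjoint union of the sets `FI([a i], T)` over a family `a` of degrees, functorially
in the finite set `T`. -/
def basis {I : Type u} (a : I → ℕ) : FI ⥤ Type u where
  obj T := Σ i : I, (FI.std (a i) ⟶ T)
  map f := TypeCat.ofHom fun x => ⟨x.1, x.2 ≫ f⟩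

/-- The direct sum `⨁ i, ℤFI([a i], -)`: the free `FI`-module with one generator in degree `a i`
for every `i`. -/
def free {I : Type u} (a : I → ℕ) : FIMod.{u} := basis a ⋙ AddCommGrpCat.free

/-- `M` is presented in degrees `≤ d`: it is the cokernel of a map between free `FI`-modules on
(possibly infinitely many) generators of degrees `≤ d`. -/
def PresentedInDegreesLE (d : ℕ) (M : FIMod.{u}) : Prop :=
  ∃ (I J : Type u) (a : I → ℕ) (b : J → ℕ) (φ : free b ⟶ free a),
    (∀ i, a i ≤ d) ∧ (∀ j, b j ≤ d) ∧ Nonempty (cokernel φ ≅ M)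

/-- `M` is presented in finite degree. -/
def PresentedInFiniteDegree (M : FIMod.{u}) : Prop :=
  ∃ d : ℕ, PresentedInDegreesLE d M

/-- `M` is eventually constant: injections between sufficiently large finite sets act by
isomorphisms. -/
def EventuallyConstant (M : FIMod.{u}) : Prop :=
  ∃ N : ℕ, ∀ (S T : FI) (f : S ⟶ T), N ≤ Nat.card S.carrier → IsIso (M.map f)

/-- `M` has polynomial degree `≤ d`. -/
def PolynomialDegreeLE : ℕ → FIMod.{u} → Prop
  | 0, M => EventuallyConstant M
  | d + 1, M => PolynomialDegreeLE d (cokernel (toShift M))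

/-- The relations `m f ⊗ x - m ⊗ f x` of the functor tensor product over `FI`, where `f` runs
over the injections `[m] → [n]`. -/
def tensorRelations (M : FIMod.{u}) (N : FIopMod.{v}) :
    AddSubgroup (DirectSum ℕ fun n => M.obj (FI.std n) ⊗[ℤ] N.obj (Opposite.op (FI.std n))) :=
  AddSubgroup.closure
    {r | ∃ (m n : ℕ) (f : FI.std m ⟶ FI.std n) (y : M.obj (FI.std m))
        (x : N.obj (Opposite.op (FI.std n))),
      r = DirectSum.of (fun n => M.obj (FI.std n) ⊗[ℤ] N.obj (Opposite.op (FI.std n))) n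
            ((M.map f).hom y ⊗ₜ[ℤ] x) -
          DirectSum.of (fun n => M.obj (FI.std n) ⊗[ℤ] N.obj (Opposite.op (FI.std n))) m
            (y ⊗ₜ[ℤ] (N.map f.op).hom x)}

/-- The functor tensor product `M ⊗_FI N`, an abelian group; it is computed over the skeleton of
`FI` on the sets `[n]`. -/
abbrev tensor (M : FIMod.{u}) (N : FIopMod.{v}) : Type (max u v) :=
  (DirectSum ℕ fun n => M.obj (FI.std n) ⊗[ℤ] N.obj (Opposite.op (FI.std n))) ⧸
    tensorRelations M N

end FIMod

namespace TailInvariant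

/-- The space `X_S = Emb(S, [ℓ] ⊔ ℝ)` of injections of the finite set `S`, with the topology of
pointwise convergence. -/
abbrev X (ℓ : ℕ) (S : FI) : Type :=
  {φ : S.carrier → Fin ℓ ⊕ ℝ // Function.Injective φ}

/-- The subspace `A_S` of those `φ` whose image does not contain `[ℓ]`. -/
abbrev A (ℓ : ℕ) (S : FI) : Type :=
  {φ : X ℓ S // ¬ Set.range (Sum.inl : Fin ℓ → Fin ℓ ⊕ ℝ) ⊆ Set.range φ.1}

/-- Precomposition with an injection, on `X`. -/
def restrictX (ℓ : ℕ) {S T : FI} (f : S ⟶ T) (φ : X ℓ T) : X ℓ S :=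
  ⟨φ.1 ∘ FI.emb f, φ.2.comp (FI.emb f).injective⟩

/-- Precomposition with an injection, on `A`. -/
def restrictA (ℓ : ℕ) {S T : FI} (f : S ⟶ T) (φ : A ℓ T) : A ℓ S :=
  ⟨restrictX ℓ f φ.1, fun h => φ.2 (h.trans
    (Set.range_comp_subset_range (FI.emb f) φ.1.1))⟩

theorem continuous_restrictX (ℓ : ℕ) {S T : FI} (f : S ⟶ T) :
    Continuous (restrictX ℓ f) := by
  refine Continuous.subtype_mk (f := fun φ : X ℓ T => φ.1 ∘ FI.emb f) ?_ _
  exact continuous_pi fun s => (continuous_apply (FI.emb f s)).comp continuous_subtype_val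

theorem continuous_restrictA (ℓ : ℕ) {S T : FI} (f : S ⟶ T) :
    Continuous (restrictA ℓ f) :=
  Continuous.subtype_mk ((continuous_restrictX ℓ f).comp continuous_subtype_val) _

/-- The pair of spaces `(X_S, A_S)`, recorded as the inclusion `A_S ⟶ X_S`, functorial in `S`
by precomposition. -/
def pair (ℓ : ℕ) : FIᵒᵖ ⥤ Arrow TopCat.{0} where
  obj S := Arrow.mk (TopCat.ofHom
    (⟨Subtype.val, continuous_subtype_val⟩ : C(A ℓ S.unop, X ℓ S.unop)))
  map f := Arrow.homMk (TopCat.ofHom ⟨restrictA ℓ f.unop, continuous_restrictA ℓ f.unop⟩)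
    (TopCat.ofHom ⟨restrictX ℓ f.unop, continuous_restrictX ℓ f.unop⟩) rfl
  map_id _ := rfl
  map_comp _ _ := rfl

/-- The relative singular chain complex `C(X) / C(A)` of a pair `A ⟶ X`, with integer
coefficients. -/
def relativeChains : Arrow TopCat.{0} ⥤ ChainComplex AddCommGrpCat.{0} ℕ :=
  ((AlgebraicTopology.singularChainComplexFunctor AddCommGrpCat.{0}).obj
    (AddCommGrpCat.of ℤ)).mapArrow ⋙ coker (ChainComplex AddCommGrpCat.{0} ℕ)

/-- The relative singular homology `H_n(X, A; ℤ)`. -/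
def relativeHomology (n : ℕ) : Arrow TopCat.{0} ⥤ AddCommGrpCat.{0} :=
  relativeChains ⋙ HomologicalComplex.homologyFunctor AddCommGrpCat.{0} (ComplexShape.down ℕ) n

/-- The `FIᵒᵖ`-module `Ξ(ℓ)`, with `Ξ(ℓ)_S = H_0(X_S, A_S)`. -/
def Xi (ℓ : ℕ) : FIopMod.{0} := pair ℓ ⋙ relativeHomology 0

end TailInvariant

end

/-! Polynomial degree `≤ d` forces a cross effect to vanish: for large `T` and any `d + 1` points of
`T`, the group `M_T` is generated by the images of injections missing at least one of them
(`PolynomialDegreeLE.vanishingCrossEffect`, by induction on `d`). On the other side, `Ξ(ℓ)_S` is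
generated by classes of injections `φ : S → [ℓ] ⊔ ℝ`, and `φ` has class zero if it misses a point of
`[ℓ]`. Since `[ℓ] ⊔ ℝ` is infinite, `φ` extends to an injection `ψ` of a large set, so `y ⊗ [φ] =
M_f(y) ⊗ [ψ]`. If `ψ` hits all of `[ℓ]`, write `M_f(y)` through injections `g` missing one of the
`ℓ` preimages; moving `g` across the tensor replaces `ψ` by `ψ ∘ g`, which misses a point of `[ℓ]`.
-/

noncomputable section

/-! ### Point classes generate relative `H_0`. -/

namespace TailInvariant

/-- The natural map from singular `0`-chains of `X` onto `H_0(X, A)`. -/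
def chainsToHomology (P : Arrow TopCat.{0}) :
    (((AlgebraicTopology.singularChainComplexFunctor AddCommGrpCat.{0}).obj
      (AddCommGrpCat.of ℤ)).obj P.right).X 0 ⟶ (relativeHomology 0).obj P :=
  ((coker.π (ChainComplex AddCommGrpCat.{0} ℕ)).app
    (((AlgebraicTopology.singularChainComplexFunctor AddCommGrpCat.{0}).obj
      (AddCommGrpCat.of ℤ)).mapArrow.obj P)).f 0 ≫
    (relativeChains.obj P).pOpcycles 0 ≫
    ((relativeChains.obj P).isoHomologyι 0 _ rfl (by simp)).inv

instance (P : Arrow TopCat.{0}) : Epi (chainsToHomology P) := by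
  let q := cokernel.π (((AlgebraicTopology.singularChainComplexFunctor AddCommGrpCat.{0}).obj
    (AddCommGrpCat.of ℤ)).map P.hom)
  have h1 : Epi (q.f 0) := inferInstance
  have h2 : Epi ((relativeChains.obj P).pOpcycles 0 ≫
    ((relativeChains.obj P).isoHomologyι 0 _ rfl (by simp)).inv) := epi_comp _ _
  exact epi_comp' h1 h2

theorem chainsToHomology_naturality {P Q : Arrow TopCat.{0}} (f : P ⟶ Q) :
    (((AlgebraicTopology.singularChainComplexFunctor AddCommGrpCat.{0}).obj
      (AddCommGrpCat.of ℤ)).map f.right).f 0 ≫ chainsToHomology Q =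
    chainsToHomology P ≫ (relativeHomology 0).map f := by
  have h := (coker.π (ChainComplex AddCommGrpCat.{0} ℕ)).naturality
    (((AlgebraicTopology.singularChainComplexFunctor AddCommGrpCat.{0}).obj
      (AddCommGrpCat.of ℤ)).mapArrow.map f)
  have h0 := congr_arg (fun k => HomologicalComplex.Hom.f k 0) h
  have h1 : (relativeChains.obj P).pOpcycles 0 ≫
      ((relativeChains.obj P).isoHomologyι 0 _ rfl (by simp)).inv ≫
        HomologicalComplex.homologyMap (relativeChains.map f) 0 =
      (relativeChains.map f).f 0 ≫ (relativeChains.obj Q).pOpcycles 0 ≫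
        ((relativeChains.obj Q).isoHomologyι 0 _ rfl (by simp)).inv := by
    rw [← HomologicalComplex.p_opcyclesMap_assoc]
    congr 1
    rw [Iso.inv_comp_eq, ← Category.assoc, Iso.eq_comp_inv]
    simp
  refine (Category.assoc _ _ _).symm.trans ((congrArg (· ≫ _) h0).trans ?_)
  refine (Category.assoc _ _ _).trans (Eq.trans ?_ (Category.assoc _ _ _).symm)
  refine congrArg _ ?_
  refine Eq.trans ?_ (Category.assoc _ _ _).symm
  exact h1.symm

theorem map_hom_chainsToHomology (P : Arrow TopCat.{0}) :
    (((AlgebraicTopology.singularChainComplexFunctor AddCommGrpCat.{0}).obj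
      (AddCommGrpCat.of ℤ)).map P.hom).f 0 ≫ chainsToHomology P = 0 := by
  have h := cokernel.condition (((AlgebraicTopology.singularChainComplexFunctor AddCommGrpCat.{0}).obj
      (AddCommGrpCat.of ℤ)).map P.hom)
  have h0 := congr_arg (fun k => HomologicalComplex.Hom.f k 0) h
  exact (Category.assoc _ _ _).symm.trans ((congrArg (· ≫ _) h0).trans zero_comp)

/-- The singular `0`-chain of a point. -/
def pointChain {X : TopCat.{0}} (x : X) : AddCommGrpCat.of ℤ ⟶
    (((AlgebraicTopology.singularChainComplexFunctor AddCommGrpCat.{0}).obj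
      (AddCommGrpCat.of ℤ)).obj X).X 0 :=
  Sigma.ι (fun _ : (TopCat.toSSet.obj X).obj (.op (.mk 0)) => AddCommGrpCat.of ℤ)
    (TopCat.toSSetObj₀Equiv.symm x)

theorem pointChain_naturality {X Y : TopCat.{0}} (f : X ⟶ Y) (x : X) :
    pointChain x ≫ (((AlgebraicTopology.singularChainComplexFunctor AddCommGrpCat.{0}).obj
      (AddCommGrpCat.of ℤ)).map f).f 0 = pointChain (f x) := by
  dsimp [pointChain, AlgebraicTopology.singularChainComplexFunctor, SSet.chainComplexFunctor]
  simp only [SimplicialObject.whiskering_obj_map_app, sigmaConst_obj_map]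
  exact (Sigma.ι_comp_map' _ _ _).trans (Category.id_comp _)

theorem chains_hom_ext {X : TopCat.{0}} {Z : AddCommGrpCat.{0}}
    {a b : (((AlgebraicTopology.singularChainComplexFunctor AddCommGrpCat.{0}).obj
      (AddCommGrpCat.of ℤ)).obj X).X 0 ⟶ Z}
    (h : ∀ x : X, pointChain x ≫ a = pointChain x ≫ b) : a = b := by
  refine Sigma.hom_ext (f := fun _ : (TopCat.toSSet.obj X).obj (.op (.mk 0)) =>
    AddCommGrpCat.of ℤ) _ _ fun σ => ?_
  obtain ⟨x, rfl⟩ := TopCat.toSSetObj₀Equiv.symm.surjective σ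
  exact h x

/-- The class of a point of `X` in `H_0(X, A)`. -/
def pointClass (P : Arrow TopCat.{0}) (x : P.right) : (relativeHomology 0).obj P :=
  (pointChain x ≫ chainsToHomology P).hom (1 : ℤ)

theorem map_pointClass {P Q : Arrow TopCat.{0}} (f : P ⟶ Q) (x : P.right) :
    ((relativeHomology 0).map f).hom (pointClass P x) = pointClass Q (f.right x) := by
  unfold pointClass
  rw [← pointChain_naturality, Category.assoc, chainsToHomology_naturality]
  rfl

theorem pointClass_hom (P : Arrow TopCat.{0}) (x : P.left) : pointClass P (P.hom x) = 0 := by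
  unfold pointClass
  rw [← pointChain_naturality, Category.assoc, map_hom_chainsToHomology]
  simp

/-- The quotient map by the span of the point classes kills every point chain, hence vanishes after
the epimorphism `chainsToHomology P`, hence is zero. -/
theorem closure_pointClass (P : Arrow TopCat.{0}) :
    AddSubgroup.closure (Set.range (pointClass P)) = ⊤ := by
  set H := AddSubgroup.closure (Set.range (pointClass P)) with hH
  have key : AddCommGrpCat.ofHom (QuotientAddGroup.mk' H) = 0 := by
    rw [← cancel_epi (chainsToHomology P)]
    refine chains_hom_ext fun x => ?_
    ext
    exact (QuotientAddGroup.eq_zero_iff (pointClass P x)).2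
      (AddSubgroup.subset_closure (Set.mem_range_self x))
  rw [← QuotientAddGroup.ker_mk' H, eq_top_iff]
  intro y _
  exact congr($(key).hom y)

end TailInvariant

/-! ### Cross effects of modules of finite polynomial degree. -/

namespace FIMod

theorem cokernel_π_app_surjective {M N : FIMod.{u}} (f : M ⟶ N) (S : FI) :
    Function.Surjective ((cokernel.π f).app S).hom :=
  (AddCommGrpCat.epi_iff_surjective _).1 inferInstance

theorem exists_of_cokernel_π_app_eq_zero {M N : FIMod.{u}} (f : M ⟶ N) (S : FI) (y : N.obj S)
    (hy : ((cokernel.π f).app S).hom y = 0) : ∃ z : M.obj S, (f.app S).hom z = y := by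
  have h := (ShortComplex.exact_cokernel f).map ((evaluation FI AddCommGrpCat.{u}).obj S)
  exact (ShortComplex.ab_exact_iff _).1 h y hy

/-- The subgroup of `M_T` generated by the images of the maps `M_g` for the injections
`g : S → T` whose image does not contain all the points `i j`. -/
def missing (M : FIMod.{u}) {ℓ : ℕ} {T : FI} (i : Fin ℓ ↪ T.carrier) : AddSubgroup (M.obj T) :=
  AddSubgroup.closure {y | ∃ (S : FI) (g : S ⟶ T) (z : M.obj S),
    (∃ j, i j ∉ Set.range (FI.emb g)) ∧ (M.map g).hom z = y}

/-- For all sufficiently large `T` and any `ℓ` points of `T`, the group `M_T` is generated by the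
images of the injections missing one of these points. -/
def VanishingCrossEffect (M : FIMod.{u}) (ℓ : ℕ) : Prop :=
  ∃ N : ℕ, ∀ (T : FI) (i : Fin ℓ ↪ T.carrier), N ≤ Nat.card T.carrier → missing M i = ⊤

theorem VanishingCrossEffect.mono {M : FIMod.{u}} {k ℓ : ℕ} (h : VanishingCrossEffect M k)
    (hkl : k ≤ ℓ) : VanishingCrossEffect M ℓ := by
  obtain ⟨N, hN⟩ := h
  refine ⟨N, fun T i hT => top_le_iff.1 ?_⟩
  rw [← hN T ((Fin.castLEEmb hkl).trans i) hT]
  refine AddSubgroup.closure_mono ?_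
  rintro y ⟨S, g, z, ⟨j, hj⟩, rfl⟩
  exact ⟨S, g, z, ⟨Fin.castLE hkl j, hj⟩, rfl⟩

theorem map_apply_comp (M : FIMod.{u}) {R S T : FI} (f : R ⟶ S) (g : S ⟶ T) (y : M.obj R) :
    (M.map g).hom ((M.map f).hom y) = (M.map (f ≫ g)).hom y := by
  rw [M.map_comp]; rfl

theorem map_surjective_of_emb_surjective (M : FIMod.{u}) {S T : FI} (f : S ⟶ T)
    (hf : Function.Surjective (FI.emb f)) : Function.Surjective (M.map f).hom := by
  let e := Equiv.ofBijective (FI.emb f) ⟨(FI.emb f).injective, hf⟩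
  let g : T ⟶ S := e.symm.toEmbedding
  have hg : g ≫ f = 𝟙 T := Function.Embedding.ext fun x => e.apply_symm_apply x
  intro y
  refine ⟨(M.map g).hom y, ?_⟩
  rw [map_apply_comp, hg, M.map_id]
  rfl

/-- Split off one point: `T ≅ [1] ⊔ T'` with `i 0` as the added point, so `M_T` is the shift at
`T'`. The image of `M_{T'}` misses `i 0`; modulo it one is in the cokernel, where the other `ℓ`
points are handled by hypothesis. -/
theorem VanishingCrossEffect.of_cokernel_toShift {M : FIMod.{u}} {ℓ : ℕ}
    (h : VanishingCrossEffect (cokernel (toShift M)) ℓ) : VanishingCrossEffect M (ℓ + 1) := by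
  obtain ⟨N, hN⟩ := h
  refine ⟨N + 1, fun T i hT => top_le_iff.1 fun y _ => ?_⟩
  let T' : FI := ⟨{t : T.carrier // t ≠ i 0}⟩
  let i' : Fin ℓ ↪ T'.carrier :=
    ⟨fun j => ⟨i j.succ, fun h => Fin.succ_ne_zero j (i.injective h)⟩, fun a b hab =>
      Fin.succ_injective _ (i.injective (congrArg Subtype.val hab))⟩
  let e : FI.addPoint.obj T' ⟶ T := (⟨Sum.elim (fun _ => i 0) Subtype.val, by
    rintro (a | a) (b | b) hab
    · exact congrArg _ (Subsingleton.elim a b)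
    · exact absurd hab.symm b.2
    · exact absurd hab a.2
    · exact congrArg _ (Subtype.ext hab)⟩ : Fin 1 ⊕ T'.carrier ↪ T.carrier)
  have he : Function.Surjective (FI.emb e) := fun t => by
    by_cases ht : t = i 0
    · exact ⟨Sum.inl 0, ht.symm⟩
    · exact ⟨Sum.inr ⟨t, ht⟩, rfl⟩
  have hT' : N ≤ Nat.card T'.carrier := by
    have h1 : Nat.card T.carrier ≤ Nat.card (Fin 1 ⊕ T'.carrier) :=
      Nat.card_le_card_of_surjective _ he
    rw [Nat.card_sum, Nat.card_fin] at h1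
    omega
  let π := ((cokernel.π (toShift M)).app T').hom
  have hker : ∀ x : M.obj (FI.addPoint.obj T'), π x = 0 → (M.map e).hom x ∈ missing M i := by
    intro x hx
    obtain ⟨z, rfl⟩ := exists_of_cokernel_π_app_eq_zero _ _ _ hx
    refine AddSubgroup.subset_closure ⟨T', FI.inclAddPoint.app T' ≫ e, z, ⟨0, ?_⟩,
      (map_apply_comp M _ _ _).symm⟩
    rintro ⟨t, ht⟩
    exact t.2 ht
  have hgen : ∀ w, w ∈ missing (cokernel (toShift M)) i' →
      ∃ x : M.obj (FI.addPoint.obj T'), (M.map e).hom x ∈ missing M i ∧ π x = w := by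
    intro w hw
    induction hw using AddSubgroup.closure_induction with
    | mem w hw =>
      obtain ⟨S, g, z, ⟨j, hj⟩, rfl⟩ := hw
      obtain ⟨z, rfl⟩ := cokernel_π_app_surjective _ _ z
      -- Adding `i 0` to an injection `g` that misses `i j.succ` gives one that still misses it.
      refine ⟨(M.map (FI.addPoint.map g)).hom z, AddSubgroup.subset_closure
        ⟨FI.addPoint.obj S, FI.addPoint.map g ≫ e, z, ⟨j.succ, ?_⟩,
          (map_apply_comp M _ _ _).symm⟩, ?_⟩
      · rintro ⟨t | t, ht⟩
        · exact Fin.succ_ne_zero j (i.injective ht).symm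
        · exact hj ⟨t, Subtype.ext ht⟩
      · exact congr($((cokernel.π (toShift M)).naturality g).hom z)
    | zero => exact ⟨0, by rw [map_zero]; exact zero_mem _, map_zero _⟩
    | add a b _ _ ha hb =>
      obtain ⟨a, ha, rfl⟩ := ha
      obtain ⟨b, hb, rfl⟩ := hb
      exact ⟨a + b, by rw [map_add]; exact add_mem ha hb, map_add _ _ _⟩
    | neg a _ ha =>
      obtain ⟨a, ha, rfl⟩ := ha
      exact ⟨-a, by rw [map_neg]; exact neg_mem ha, map_neg _ _⟩
  obtain ⟨y, rfl⟩ := map_surjective_of_emb_surjective M e he y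
  obtain ⟨x, hx, hxy⟩ := hgen (π y) (by rw [hN T' i' hT']; trivial)
  have := add_mem hx (hker (y - x) ((map_sub π y x).trans (sub_eq_zero.2 hxy.symm)))
  rwa [← map_add, add_sub_cancel] at this

theorem EventuallyConstant.vanishingCrossEffect {M : FIMod.{u}} (h : EventuallyConstant M) :
    VanishingCrossEffect M 1 := by
  obtain ⟨N, hN⟩ := h
  -- With `ℓ = 0` no point can be missed, so `missing` is trivial and the claim is that the cokernel
  -- vanishes on large sets.
  refine VanishingCrossEffect.of_cokernel_toShift ⟨N, fun T i hT => top_le_iff.1 fun w _ => ?_⟩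
  obtain ⟨x, rfl⟩ := cokernel_π_app_surjective _ _ w
  have := hN _ _ (FI.inclAddPoint.app T) hT
  obtain ⟨z, rfl⟩ := (AddCommGrpCat.epi_iff_surjective (M.map (FI.inclAddPoint.app T))).1
    inferInstance x
  have h0 : (toShift M).app T ≫ (cokernel.π (toShift M)).app T = 0 := by
    rw [← NatTrans.comp_app, cokernel.condition]; rfl
  have h1 : ((cokernel.π (toShift M)).app T).hom (((toShift M).app T).hom z) = 0 :=
    congr($(h0).hom z)
  exact h1 ▸ zero_mem _

theorem PolynomialDegreeLE.vanishingCrossEffect {d : ℕ} : ∀ {M : FIMod.{u}},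
    PolynomialDegreeLE d M → VanishingCrossEffect M (d + 1) := by
  induction d with
  | zero => exact fun h => EventuallyConstant.vanishingCrossEffect h
  | succ d ih => exact fun h => (ih h).of_cokernel_toShift

end FIMod

/-! ### Vanishing of the pure tensors. -/

namespace TailInvariant

theorem exists_restrictX_eq {ℓ n : ℕ} (φ : X ℓ (FI.std n)) (N : ℕ) :
    ∃ (f : FI.std n ⟶ FI.std (n + N)) (ψ : X ℓ (FI.std (n + N))), restrictX ℓ f ψ = φ := by
  -- The new values may lie in `[ℓ]` as well as in `ℝ`; only injectivity matters.
  have hinf : Infinite ↥(Set.range φ.1)ᶜ := (Set.finite_range φ.1).infinite_compl.to_subtype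
  let α : Fin N → Fin ℓ ⊕ ℝ := fun k => (Infinite.natEmbedding ↥(Set.range φ.1)ᶜ k).1
  have hα : Function.Injective α := Subtype.val_injective.comp
    ((Infinite.natEmbedding _).injective.comp Fin.val_injective)
  refine ⟨(Fin.castAddEmb N : Fin n ↪ Fin (n + N)), ⟨(Fin.append φ.1 α :), ?_⟩, ?_⟩
  · exact Fin.append_injective_iff.2 ⟨φ.2, hα, fun a b hab =>
      (Infinite.natEmbedding ↥(Set.range φ.1)ᶜ b).2 ⟨a, hab⟩⟩
  · exact Subtype.ext (funext fun k => Fin.append_left φ.1 α k)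

/-- The class of an injection `S → [ℓ] ⊔ ℝ` in `Ξ(ℓ)_S`. -/
def XiClass (ℓ : ℕ) {S : FI} (φ : X ℓ S) : (Xi ℓ).obj (.op S) :=
  pointClass ((pair ℓ).obj (.op S)) φ

theorem map_XiClass (ℓ : ℕ) {S T : FI} (f : S ⟶ T) (φ : X ℓ T) :
    ((Xi ℓ).map f.op).hom (XiClass ℓ φ) = XiClass ℓ (restrictX ℓ f φ) :=
  map_pointClass ((pair ℓ).map f.op) φ

theorem XiClass_eq_zero (ℓ : ℕ) {S : FI} (φ : X ℓ S)
    (h : ¬ Set.range (Sum.inl : Fin ℓ → Fin ℓ ⊕ ℝ) ⊆ Set.range φ.1) : XiClass ℓ φ = 0 :=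
  pointClass_hom ((pair ℓ).obj (.op S)) (⟨φ, h⟩ : A ℓ S)

theorem closure_XiClass (ℓ : ℕ) (S : FI) :
    AddSubgroup.closure (Set.range (XiClass ℓ (S := S))) = ⊤ :=
  closure_pointClass ((pair ℓ).obj (.op S))

/-- The class of a pure tensor in `M ⊗_FI N`, as a biadditive map. -/
def mkTensor (M : FIMod.{u}) (N : FIopMod.{v}) (n : ℕ) :
    M.obj (FI.std n) →+ N.obj (.op (FI.std n)) →+ FIMod.tensor M N :=
  AddMonoidHom.mk' (fun y => ((QuotientAddGroup.mk' (FIMod.tensorRelations M N)).comp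
    ((DirectSum.of (fun n => M.obj (FI.std n) ⊗[ℤ] N.obj (Opposite.op (FI.std n))) n).comp
      (TensorProduct.mk ℤ _ _ y).toAddMonoidHom))) fun a b => by
    ext x
    simp

theorem mkTensor_map (M : FIMod.{u}) (N : FIopMod.{v}) {m n : ℕ} (f : FI.std m ⟶ FI.std n)
    (y : M.obj (FI.std m)) (x : N.obj (.op (FI.std n))) :
    mkTensor M N n ((M.map f).hom y) x = mkTensor M N m y ((N.map f.op).hom x) := by
  refine sub_eq_zero.1 ((QuotientAddGroup.eq_zero_iff _).2
    (AddSubgroup.subset_closure ⟨m, n, f, y, x, rfl⟩))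

theorem subsingleton_tensor (M : FIMod.{u}) (N : FIopMod.{v})
    (h : ∀ n y x, mkTensor M N n y x = 0) : Subsingleton (FIMod.tensor M N) := by
  refine subsingleton_of_forall_eq 0 fun t => ?_
  induction t using QuotientAddGroup.induction_on with | H t => ?_
  induction t using DirectSum.induction_on with
  | zero => rfl
  | add a b ha hb => rw [QuotientAddGroup.mk_add, ha, hb, add_zero]
  | of n t =>
    induction t using TensorProduct.induction_on with
    | zero => rw [map_zero]; rfl
    | add a b ha hb => rw [map_add, QuotientAddGroup.mk_add, ha, hb, add_zero]
    | tmul y x => exact h n y x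

theorem mkTensor_XiClass_eq_zero (M : FIMod.{u}) {ℓ m : ℕ} (φ : X ℓ (FI.std m))
    (h : ∀ i : Fin ℓ ↪ (FI.std m).carrier, FIMod.missing M i = ⊤) (y : M.obj (FI.std m)) :
    mkTensor M (Xi ℓ) m y (XiClass ℓ φ) = 0 := by
  by_cases hφ : Set.range (Sum.inl : Fin ℓ → Fin ℓ ⊕ ℝ) ⊆ Set.range φ.1
  swap
  · rw [XiClass_eq_zero ℓ φ hφ, map_zero]
  -- The preimages of `[ℓ]` under `φ` are the `ℓ` points fed to the cross effect.
  choose i hi using fun j : Fin ℓ => hφ (Set.mem_range_self j)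
  have hinj : Function.Injective i := fun a b hab => Sum.inl_injective (by rw [← hi, ← hi, hab])
  have hy : y ∈ FIMod.missing M ⟨i, hinj⟩ := (h ⟨i, hinj⟩).symm ▸ AddSubgroup.mem_top y
  induction hy using AddSubgroup.closure_induction with
  | mem y hy =>
    obtain ⟨S, g, z, ⟨j, hj⟩, rfl⟩ := hy
    -- The tensor relations only involve the sets `[n]`, so `S` is first replaced by one of them.
    let e : FI.std (Nat.card S.carrier) ⟶ S := (Finite.equivFin S.carrier).symm.toEmbedding
    obtain ⟨z, rfl⟩ := FIMod.map_surjective_of_emb_surjective M e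
      (Finite.equivFin S.carrier).symm.surjective z
    rw [FIMod.map_apply_comp, mkTensor_map, map_XiClass, XiClass_eq_zero, map_zero]
    intro hsub
    obtain ⟨k, hk⟩ := hsub (Set.mem_range_self j)
    exact hj ⟨FI.emb e k, φ.2 (hk.trans (hi j).symm)⟩
  | zero => rw [map_zero, AddMonoidHom.zero_apply]
  | add a b _ _ ha hb => rw [map_add, AddMonoidHom.add_apply, ha, hb, add_zero]
  | neg a _ ha => rw [map_neg, AddMonoidHom.neg_apply, ha, neg_zero]

end TailInvariant

end

theorem mainTheorem10 (M : FIMod.{u}) (hM : FIMod.PresentedInFiniteDegree M)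
    (d : ℕ) (hd : FIMod.PolynomialDegreeLE d M) (ℓ : ℕ) (hℓ : d < ℓ) :
    Subsingleton (FIMod.tensor M (TailInvariant.Xi ℓ)) := by
  obtain ⟨N, hN⟩ := hd.vanishingCrossEffect.mono hℓ
  refine TailInvariant.subsingleton_tensor _ _ fun n y x => ?_
  have hx : x ∈ AddSubgroup.closure (Set.range (TailInvariant.XiClass ℓ (S := FI.std n))) := by
    rw [TailInvariant.closure_XiClass]; trivial
  induction hx using AddSubgroup.closure_induction with
  | mem x hx =>
    obtain ⟨φ, rfl⟩ := hx
    -- Adding `N` points brings the set into the range where the cross effect vanishes.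
    obtain ⟨f, ψ, rfl⟩ := TailInvariant.exists_restrictX_eq φ N
    rw [← TailInvariant.map_XiClass, ← TailInvariant.mkTensor_map]
    have hcard : N ≤ Nat.card (FI.std (n + N)).carrier :=
      (Nat.le_add_left N n).trans_eq (Nat.card_fin (n + N)).symm
    exact TailInvariant.mkTensor_XiClass_eq_zero M ψ (fun i => hN (FI.std (n + N)) i hcard) _
  | zero => rw [map_zero]
  | add a b _ _ ha hb => rw [map_add, ha, hb, add_zero]
  | neg a _ ha => rw [map_neg, ha, neg_zero]
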